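/- **Conventions.** All objects below are sequences (or families over an arbitrary index set, not displayed): dimensions $p,n\in\mathbb N$, integers $m\in\mathbb N$, reals $\sigma,\kappa>0$, probability spaces, and random matrices $X$. The exponent $q>0$ is fixed, and "constant" means independent of the index. On real matrices, $\|M\|_F=\sqrt{\operatorname{tr}(MM^T)}$, $\|M\|$ is the spectral norm, and $\|M\|_*=\operatorname{tr}\sqrt{MM^T}$ is the nuclear norm. Let $Z$ be a random vector of a normed space $(E,\|\cdot\|_E)$. * $Z\propto_c\mathcal E_q(\sigma)$ in $(E,\|\cdot\|_E)$ means: there are constants $C,c>0$ such that for every $1$-Lipschitz quasi-convex $f:E\to\mathbb R$ (all sublevel sets $\{f\le r\}$ convex), $f(Z)$ is integrable and $\mathbb P(|f(Z)-\mathbb E[f(Z)]|\ge t)\le Ce^{-(t/c\sigma)^q}$ for all $t>0$. * $Z\in\mathcal E_q(\sigma)$ in $(E,\|\cdot\|_E)$ means: there are a deterministic $\tilde Z\in E$ and constants $C,c>0$ such that for every linear form $f$ with $|f(x)|\le\|x\|_E$ for all $x$, $\mathbb P(|f(Z)-f(\tilde Z)|\ge t)\le Ce^{-(t/c\sigma)^q}$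 for all $t>0$. * Adding "$\,|\ e^{-\theta}$" to either property means: there is an event $\mathcal A$ with $\mathbb P(\mathcal A)>0$ and $\mathbb P(\mathcal A^c)\le Ce^{-\theta/c}$ for some constants $C,c>0$, such that $Z$ has the property under the conditional probability $\mathbb P(\,\cdot\mid\mathcal A)$. **Proposition.** (1) Let $X\in\mathcal M_p(\mathbb R)$ be a random matrix such that $X\propto_c\mathcal E_q(\sigma)$ in $(\mathcal M_p,\|\cdot\|_F)$ (or, more generally, $X\propto_c\mathcal E_q(\sigma)\ |\ e^{-p}$), and suppose that $\mathbb P(\|X\|\ge\kappa)\le Ce^{-cp}$ for some constants $C,c>0$. Then $$X^m\in\mathcal E_q\big(\sqrt p\,(2e\kappa)^{m-1}\sigma\big)\ \big|\ e^{-p}\quad\text{in }(\mathcal M_p,\|\cdot\|_*).$$ (2) Let $X\in\mathcal M_{p,n}(\mathbb R)$ be a random matrix such that $X\propto_c\mathcal E_q(\sigma)$ in $(\mathcal M_{p,n},\|\cdot\|_F)$ (or, more generally, $X\propto_c\mathcal E_q(\sigma)\ |\ e^{-(p+n)}$). Suppose that $\mathbb P(\|X\|\ge\kappa)\le Ce^{-c(p+n)}$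 for some constants $C,c>0$, that $X$ is integrable, and that $\|\mathbb E[X]\|\le K(p+n)^{1/q}$ for some constant $K$. Then $$(XX^T)^m\in\mathcal E_q\big(\sqrt{p+n}\,(2e\kappa)^{2m-1}\sigma\big)\ \big|\ e^{-(p+n)}\quad\text{in }(\mathcal M_p,\|\cdot\|_*),$$ $$(XX^T)^mX\in\mathcal E_q\big(\sqrt{p+n}\,(2e\kappa)^{2m}\sigma\big)\ \big|\ e^{-(p+n)}\quad\text{in }(\mathcal M_{p,n},\|\cdot\|_*).$$ -/

import Mathlib

open MeasureTheory ProbabilityTheory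

noncomputable section

namespace MatrixConcentration

/-- The Frobenius norm `‖M‖_F = √(tr (M Mᵀ))`. -/
def frobeniusNorm {p n : ℕ} (M : Matrix (Fin p) (Fin n) ℝ) : ℝ :=
  Real.sqrt (M * M.transpose).trace

/-- The spectral norm: the operator norm of `M` between Euclidean spaces. -/
def spectralNorm {p n : ℕ} (M : Matrix (Fin p) (Fin n) ℝ) : ℝ :=
  letI := Matrix.instL2OpNormedAddCommGroup (m := Fin p) (n := Fin n) (𝕜 := ℝ)
  ‖M‖

/-- The nuclear norm `‖M‖_* = tr √(M Mᵀ)`, the square root being that of the functional calculus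
of symmetric matrices. -/
def nuclearNorm {p n : ℕ} (M : Matrix (Fin p) (Fin n) ℝ) : ℝ :=
  (cfc Real.sqrt (M * M.transpose)).trace

/-- A random matrix: a matrix-valued map with measurable entries (equivalently, a Borel map). -/
def IsRandomMatrix {Ω : Type*} [MeasurableSpace Ω] {p n : ℕ}
    (X : Ω → Matrix (Fin p) (Fin n) ℝ) : Prop :=
  ∀ i j, Measurable fun ω => X ω i j

/-- The expectation of a random matrix, taken entrywise. -/
def matrixMean {Ω : Type*} [MeasurableSpace Ω] (μ : Measure Ω) {p n : ℕ}
    (X : Ω → Matrix (Fin p) (Fin n) ℝ) : Matrix (Fin p) (Fin n) ℝ :=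
  Matrix.of fun i j => ∫ ω, X ω i j ∂μ

section Concentration

/- Families of random vectors `Z k : Ω k → E k`, where `E k` carries the norm `nrm k`. The index
set is arbitrary: for sequences take `ι = ℕ`. Constants never depend on the index. -/
variable {ι : Type*} {Ω : ι → Type*} [∀ k, MeasurableSpace (Ω k)]
  {E : ι → Type*} [∀ k, AddCommGroup (E k)] [∀ k, Module ℝ (E k)]

/-- Convex concentration `Z ∝_c 𝓔_q(σ)` in `(E, nrm)`: all observations of `Z` through
1-Lipschitz quasi-convex functions are integrable and `q`-exponentially concentrated around their
expectation with diameter `O(σ)`. -/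
def ConvexlyConcentrated (μ : ∀ k, Measure (Ω k)) (nrm : ∀ k, E k → ℝ)
    (Z : ∀ k, Ω k → E k) (q : ℝ) (σ : ι → ℝ) : Prop :=
  ∃ C c : ℝ, 0 < C ∧ 0 < c ∧ ∀ k, ∀ f : E k → ℝ,
    (∀ x y, |f x - f y| ≤ nrm k (x - y)) → QuasiconvexOn ℝ Set.univ f →
      Integrable (fun ω => f (Z k ω)) (μ k) ∧
      ∀ t : ℝ, 0 < t →
        (μ k).real {ω | t ≤ |f (Z k ω) - ∫ ω', f (Z k ω') ∂(μ k)|}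
          ≤ C * Real.exp (-(t / (c * σ k)) ^ q)

/-- Linear concentration `Z ∈ Z̃ ± 𝓔_q(σ)` in `(E, nrm)` around the deterministic family `Z̃`. -/
def LinearlyConcentratedAround (μ : ∀ k, Measure (Ω k)) (nrm : ∀ k, E k → ℝ)
    (Z : ∀ k, Ω k → E k) (Ztilde : ∀ k, E k) (q : ℝ) (σ : ι → ℝ) : Prop :=
  ∃ C c : ℝ, 0 < C ∧ 0 < c ∧ ∀ k, ∀ f : E k →ₗ[ℝ] ℝ, (∀ x, |f x| ≤ nrm k x) →
    ∀ t : ℝ, 0 < t →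
      (μ k).real {ω | t ≤ |f (Z k ω) - f (Ztilde k)|} ≤ C * Real.exp (-(t / (c * σ k)) ^ q)

/-- Linear concentration `Z ∈ 𝓔_q(σ)`: around some deterministic equivalent. -/
def LinearlyConcentrated (μ : ∀ k, Measure (Ω k)) (nrm : ∀ k, E k → ℝ)
    (Z : ∀ k, Ω k → E k) (q : ℝ) (σ : ι → ℝ) : Prop :=
  ∃ Ztilde : ∀ k, E k, LinearlyConcentratedAround μ nrm Z Ztilde q σ

/-- `A` is a family of events of positive probability with `ℙ(Aᶜ) ≤ C exp(-θ / c)`. -/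
def HighlyProbable (μ : ∀ k, Measure (Ω k)) (A : ∀ k, Set (Ω k)) (θ : ι → ℝ) : Prop :=
  (∀ k, MeasurableSet (A k) ∧ 0 < μ k (A k)) ∧
    ∃ C c : ℝ, 0 < C ∧ 0 < c ∧ ∀ k, (μ k).real (A k)ᶜ ≤ C * Real.exp (-(θ k / c))

/-- Convex concentration under a highly probable event, `Z ∝_c 𝓔_q(σ) | e^{-θ}`. -/
def ConvexlyConcentratedUnder (μ : ∀ k, Measure (Ω k)) (nrm : ∀ k, E k → ℝ)
    (Z : ∀ k, Ω k → E k) (q : ℝ) (σ θ : ι → ℝ) : Prop :=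
  ∃ A : ∀ k, Set (Ω k), HighlyProbable μ A θ ∧
    ConvexlyConcentrated (fun k => cond (μ k) (A k)) nrm Z q σ

/-- Linear concentration under a highly probable event, `Z ∈ 𝓔_q(σ) | e^{-θ}`. -/
def LinearlyConcentratedUnder (μ : ∀ k, Measure (Ω k)) (nrm : ∀ k, E k → ℝ)
    (Z : ∀ k, Ω k → E k) (q : ℝ) (σ θ : ι → ℝ) : Prop :=
  ∃ A : ∀ k, Set (Ω k), HighlyProbable μ A θ ∧
    LinearlyConcentrated (fun k => cond (μ k) (A k)) nrm Z q σ

end Concentration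

end MatrixConcentration

end

/-! A linear form `f` bounded by the nuclear norm satisfies `|f (P * Q)| ≤ ‖P‖ * ‖Q‖` in Frobenius
norms: expand the product into rank-one terms and apply Cauchy–Schwarz. Hence on the spectral ball
of radius `κ` the Jensen gap of `X ↦ f (X ^ k)` is at most `k² κ^(k-2)` times that of `‖X‖²`
(`MulBounded.jensen_gap_le`). Adding that multiple of `‖X‖²` makes the function convex, so `f (X ^
k)` is a difference of two convex functions. Both are Lipschitz on the ball with constant of order
`k² κ^(k-1) √p`, because `‖X‖ ≤ √p κ` there; the factor `k²` is absorbed by powers of `2e`.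

The two functions extend to the whole space with the same Lipschitz constant, and convex
concentration applies to each. On the event that `X` lies in the ball, `f (X ^ k)` then concentrates
around a constant depending on `f`, hence also around its conditional mean, which is `f` of one
matrix common to all `f`.

The rectangular statements are read off blocks of powers of the symmetric dilation. If the good
event has probability below one half, the required bound on the complement is vacuous up to
constants, and an event where `X` is almost constant serves instead. -/

noncomputable section

namespace MatrixConcentration

/-! ### Convex Lipschitz extension. -/

section Extension

variable {E : Type*} [NormedAddCommGroup E] [NormedSpace ℝ E]

/-- A convex Lipschitz function on a nonempty convex set extends to a convex function on the whole
space with the same Lipschitz constant. -/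
theorem exists_convex_lipschitz_extension {S : Set E} (hne : S.Nonempty) {h : E → ℝ}
    (hconv : ConvexOn ℝ S h) {L : ℝ} (hL : 0 ≤ L)
    (hlip : ∀ x ∈ S, ∀ y ∈ S, |h x - h y| ≤ L * ‖x - y‖) :
    ∃ g : E → ℝ, ConvexOn ℝ Set.univ g ∧ (∀ x y, |g x - g y| ≤ L * ‖x - y‖) ∧
      ∀ x ∈ S, g x = h x := by
  obtain ⟨y₀, hy₀⟩ := hne
  have : Nonempty S := ⟨⟨y₀, hy₀⟩⟩
  -- The extension is the infimal convolution of `h` with `L‖·‖` over `S`: an infimum of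
  -- `L`-Lipschitz functions of `x`, convex because `F` is jointly convex and `S` is convex.
  let F : E → S → ℝ := fun x y => h y + L * ‖x - y‖
  have hbdd : ∀ x, BddBelow (Set.range (F x)) := by
    intro x
    refine ⟨h y₀ - L * ‖x - y₀‖, ?_⟩
    rintro _ ⟨y, rfl⟩
    have h1 := (abs_le.mp (hlip y₀ hy₀ y y.2)).2
    have h2 : ‖y₀ - (y : E)‖ ≤ ‖x - y₀‖ + ‖x - y‖ := by
      rw [← norm_neg (x - y₀)]
      refine le_trans (le_of_eq ?_) (norm_add_le _ _)
      congr 1; abel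
    have h3 := mul_le_mul_of_nonneg_left h2 hL
    simp only [F]
    linarith
  have hle : ∀ x (y : S), (⨅ y, F x y) ≤ F x y := fun x y => ciInf_le (hbdd x) y
  have hone : ∀ x y, (⨅ z, F x z) ≤ (⨅ z, F y z) + L * ‖x - y‖ := by
    intro x y
    rw [← sub_le_iff_le_add]
    refine le_ciInf fun z => ?_
    have h1 := hle x z
    have h2 : ‖x - (z : E)‖ ≤ ‖x - y‖ + ‖y - z‖ := norm_sub_le_norm_sub_add_norm_sub x y z
    have h3 := mul_le_mul_of_nonneg_left h2 hL
    simp only [F] at h1 ⊢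
    linarith
  refine ⟨fun x => ⨅ y, F x y, ⟨convex_univ, ?_⟩, ?_, ?_⟩
  · intro x₁ _ x₂ _ a b ha hb hab
    simp only [smul_eq_mul]
    refine le_of_forall_pos_le_add fun ε hε => ?_
    obtain ⟨y₁, hy₁⟩ := exists_lt_of_ciInf_lt (lt_add_of_pos_right (⨅ y, F x₁ y) hε)
    obtain ⟨y₂, hy₂⟩ := exists_lt_of_ciInf_lt (lt_add_of_pos_right (⨅ y, F x₂ y) hε)
    have h0 := hle (a • x₁ + b • x₂) ⟨a • (y₁ : E) + b • (y₂ : E), hconv.1 y₁.2 y₂.2 ha hb hab⟩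
    have h1 := hconv.2 y₁.2 y₂.2 ha hb hab
    have h2 : ‖a • x₁ + b • x₂ - (a • (y₁ : E) + b • (y₂ : E))‖
        ≤ a * ‖x₁ - y₁‖ + b * ‖x₂ - y₂‖ := by
      have : a • x₁ + b • x₂ - (a • (y₁ : E) + b • (y₂ : E))
          = a • (x₁ - (y₁ : E)) + b • (x₂ - (y₂ : E)) := by
        simp only [smul_sub]; abel
      rw [this]
      refine (norm_add_le _ _).trans (le_of_eq ?_)
      rw [norm_smul, norm_smul, Real.norm_of_nonneg ha, Real.norm_of_nonneg hb]
    have h3 := mul_le_mul_of_nonneg_left h2 hL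
    have h4 := mul_le_mul_of_nonneg_left hy₁.le ha
    have h5 := mul_le_mul_of_nonneg_left hy₂.le hb
    have h6 : a * ε + b * ε = ε := by rw [← add_mul, hab, one_mul]
    simp only [F, smul_eq_mul] at h0 h1 h4 h5 ⊢
    linarith
  · intro x y
    have h1 := hone x y
    have h2 := hone y x
    rw [norm_sub_rev y x] at h2
    rw [abs_le]
    constructor <;> linarith
  · intro x hx
    refine le_antisymm ?_ (le_ciInf fun y => ?_)
    · simpa [F] using hle x ⟨x, hx⟩
    · have := (abs_le.mp (hlip x hx y y.2)).2
      simp only [F]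
      linarith

end Extension

/-! ### Jensen gaps of matrix powers in the Frobenius norm. -/

section Frobenius

open scoped Matrix.Norms.Frobenius

variable {l m n : Type*} [Fintype l] [Fintype m] [Fintype n]

theorem norm_sq_eq_sum (M : Matrix m n ℝ) : ‖M‖ ^ 2 = ∑ i, ∑ j, M i j ^ 2 := by
  rw [Matrix.frobenius_norm_def, ← Real.sqrt_eq_rpow, Real.sq_sqrt (by positivity)]
  simp

theorem frobeniusNorm_eq_norm {p n : ℕ} (M : Matrix (Fin p) (Fin n) ℝ) :
    frobeniusNorm M = ‖M‖ := by
  rw [frobeniusNorm, ← Real.sqrt_sq (norm_nonneg M), norm_sq_eq_sum]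
  simp [Matrix.trace, Matrix.mul_apply, sq]

/-- Being an equality, this turns any bound of order `a * b * ‖X - Y‖ ^ 2` on a Jensen gap into
convexity after adding a multiple of the squared norm. -/
theorem norm_sq_jensen_gap (X Y : Matrix m n ℝ) {a b : ℝ} (hab : a + b = 1) :
    a * ‖X‖ ^ 2 + b * ‖Y‖ ^ 2 - ‖a • X + b • Y‖ ^ 2 = a * b * ‖X - Y‖ ^ 2 := by
  obtain rfl : b = 1 - a := by linarith
  simp only [norm_sq_eq_sum, Finset.mul_sum, ← Finset.sum_add_distrib, ← Finset.sum_sub_distrib]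
  refine Finset.sum_congr rfl fun i _ => Finset.sum_congr rfl fun j _ => ?_
  simp only [Matrix.add_apply, Matrix.sub_apply, Matrix.smul_apply, smul_eq_mul]
  ring

/-- Multiplication by `X` on either side is bounded by `κ` for the Frobenius norm. -/
def MulBounded (κ : ℝ) (X : Matrix n n ℝ) : Prop :=
  ∀ P : Matrix n n ℝ, ‖X * P‖ ≤ κ * ‖P‖ ∧ ‖P * X‖ ≤ κ * ‖P‖

variable [DecidableEq n] {κ : ℝ} {X Y : Matrix n n ℝ}

theorem norm_one_eq_sqrt_card : ‖(1 : Matrix n n ℝ)‖ = Real.sqrt (Fintype.card n) := by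
  rw [← Real.sqrt_sq (norm_nonneg (1 : Matrix n n ℝ)), norm_sq_eq_sum]
  simp [Matrix.one_apply]

theorem MulBounded.norm_le (hX : MulBounded κ X) : ‖X‖ ≤ Real.sqrt (Fintype.card n) * κ := by
  simpa [norm_one_eq_sqrt_card, mul_comm] using (hX 1).1

theorem MulBounded.norm_pow_mul_le (hκ : 0 < κ) (hX : MulBounded κ X) (k : ℕ)
    (P : Matrix n n ℝ) : ‖X ^ k * P‖ ≤ κ ^ k * ‖P‖ := by
  induction k with
  | zero => simp
  | succ k ih =>
    rw [pow_succ', Matrix.mul_assoc, pow_succ', mul_assoc]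
    exact (hX _).1.trans (mul_le_mul_of_nonneg_left ih hκ.le)

/-- Telescoping. Writing `κ ^ k / κ` avoids truncated subtraction in the exponent at `k = 0`. -/
theorem MulBounded.norm_pow_sub_pow_le (hκ : 0 < κ) (hX : MulBounded κ X) (hY : MulBounded κ Y)
    (k : ℕ) : ‖X ^ k - Y ^ k‖ ≤ k * (κ ^ k / κ) * ‖X - Y‖ := by
  induction k with
  | zero => simp
  | succ k ih =>
    have h : X ^ (k + 1) - Y ^ (k + 1) = X ^ k * (X - Y) + (X ^ k - Y ^ k) * Y := by
      rw [pow_succ, pow_succ]; noncomm_ring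
    rw [h]
    refine (norm_add_le _ _).trans ?_
    have h1 := hX.norm_pow_mul_le hκ k (X - Y)
    have h2 := (hY (X ^ k - Y ^ k)).2.trans (mul_le_mul_of_nonneg_left ih hκ.le)
    refine (add_le_add h1 h2).trans (le_of_eq ?_)
    push_cast
    field_simp
    ring

/-- Induction on `k`, peeling off one factor on the right. Quantifying over `f` and `r` after `k`
lets the induction absorb right multiplication by the convex combination into the form, with `r`
becoming `r * κ`. -/
theorem MulBounded.jensen_gap_le (hκ : 0 < κ) (hX : MulBounded κ X) (hY : MulBounded κ Y)
    {a b : ℝ} (ha : 0 ≤ a) (hb : 0 ≤ b) (hab : a + b = 1)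
    (hZ : MulBounded κ (a • X + b • Y)) (k : ℕ) :
    ∀ (f : Matrix n n ℝ →ₗ[ℝ] ℝ) (r : ℝ), 0 ≤ r →
      (∀ P Q : Matrix n n ℝ, |f (P * Q)| ≤ r * (‖P‖ * ‖Q‖)) →
      |f (a • X ^ k + b • Y ^ k - (a • X + b • Y) ^ k)|
        ≤ r * (k ^ 2 * (κ ^ k / κ ^ 2)) * (a * b * ‖X - Y‖ ^ 2) := by
  induction k with
  | zero =>
    intro f r hr _
    simp [← add_smul, hab]
  | succ k ih =>
    intro f r hr hf
    set Z := a • X + b • Y with hZdef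
    have hXZ : X - Z = b • (X - Y) := by
      obtain rfl : a = 1 - b := by linarith
      rw [hZdef]; module
    have hYZ : Y - Z = -(a • (X - Y)) := by
      obtain rfl : b = 1 - a := by linarith
      rw [hZdef]; module
    -- Since `X - Z = b • (X - Y)` and `Y - Z = -a • (X - Y)`, the new term carries the factor `a *
    -- b` and is a product of two differences, hence quadratic in `X - Y`.
    have h : a • X ^ (k + 1) + b • Y ^ (k + 1) - Z ^ (k + 1)
        = (a • X ^ k + b • Y ^ k - Z ^ k) * Z + (a * b) • ((X ^ k - Y ^ k) * (X - Y)) := by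
      have : a • X ^ (k + 1) + b • Y ^ (k + 1) - Z ^ (k + 1)
          = (a • X ^ k + b • Y ^ k - Z ^ k) * Z + a • (X ^ k * (X - Z)) +
            b • (Y ^ k * (Y - Z)) := by
        simp only [pow_succ, mul_sub, sub_mul, add_mul, smul_mul_assoc, smul_sub]
        abel
      rw [this, hXZ, hYZ]
      rw [mul_neg, Matrix.mul_smul, Matrix.mul_smul, sub_mul (X ^ k)]
      module
    rw [h, map_add, map_smul, smul_eq_mul]
    have h1 := ih (f ∘ₗ LinearMap.mulRight ℝ Z) (r * κ) (by positivity) (by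
      intro P Q
      simp only [LinearMap.comp_apply, LinearMap.mulRight_apply, Matrix.mul_assoc]
      refine (hf P (Q * Z)).trans ?_
      have := (hZ Q).2
      calc r * (‖P‖ * ‖Q * Z‖) ≤ r * (‖P‖ * (κ * ‖Q‖)) := by gcongr
        _ = _ := by ring)
    simp only [LinearMap.comp_apply, LinearMap.mulRight_apply] at h1
    have h2 : |f ((X ^ k - Y ^ k) * (X - Y))|
        ≤ r * (k * (κ ^ k / κ) * ‖X - Y‖ * ‖X - Y‖) := by
      refine (hf _ _).trans ?_
      have := hX.norm_pow_sub_pow_le hκ hY k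
      gcongr
    have h3 : |a * b * f ((X ^ k - Y ^ k) * (X - Y))|
        ≤ a * b * (r * (k * (κ ^ k / κ) * ‖X - Y‖ * ‖X - Y‖)) := by
      rw [abs_mul, abs_of_nonneg (by positivity : 0 ≤ a * b)]
      gcongr
    refine (abs_add_le _ _).trans ((add_le_add h1 h3).trans ?_)
    have h4 : r * κ * (k ^ 2 * (κ ^ k / κ ^ 2)) * (a * b * ‖X - Y‖ ^ 2) +
        a * b * (r * (k * (κ ^ k / κ) * ‖X - Y‖ * ‖X - Y‖))
        = r * ((k ^ 2 + k) * (κ ^ (k + 1) / κ ^ 2)) * (a * b * ‖X - Y‖ ^ 2) := by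
      field_simp
      ring
    rw [h4]
    have h5 : (k : ℝ) ^ 2 + k ≤ ((k + 1 : ℕ) : ℝ) ^ 2 := by
      push_cast
      nlinarith [(Nat.cast_nonneg k : (0 : ℝ) ≤ k)]
    gcongr

/-- On a convex set of matrices of bounded multiplication norm, a matrix power composed with a
suitable linear form is a difference of two convex Lipschitz functions. -/
theorem exists_convex_decomposition_pow (hκ : 0 < κ) {S : Set (Matrix n n ℝ)}
    (hS : Convex ℝ S) (hbound : ∀ X ∈ S, MulBounded κ X) {f : Matrix n n ℝ →ₗ[ℝ] ℝ}
    (hf : ∀ P Q : Matrix n n ℝ, |f (P * Q)| ≤ ‖P‖ * ‖Q‖) (k : ℕ) :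
    ∃ h₁ h₂ : Matrix n n ℝ → ℝ, ConvexOn ℝ S h₁ ∧ ConvexOn ℝ S h₂ ∧
      (∀ X ∈ S, ∀ Y ∈ S, |h₁ X - h₁ Y|
        ≤ 3 * k ^ 2 * (κ ^ k / κ) * Real.sqrt (Fintype.card n) * ‖X - Y‖) ∧
      (∀ X ∈ S, ∀ Y ∈ S, |h₂ X - h₂ Y|
        ≤ 3 * k ^ 2 * (κ ^ k / κ) * Real.sqrt (Fintype.card n) * ‖X - Y‖) ∧
      ∀ X, f (X ^ k) = h₁ X - h₂ X := by
  -- The constant of `MulBounded.jensen_gap_le` at `r = 1`; the decomposition is `(f (X ^ k) +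
  -- c‖X‖²) - c‖X‖²`.
  set c : ℝ := k ^ 2 * (κ ^ k / κ ^ 2) with hc
  have hc0 : 0 ≤ c := by positivity
  set d := Real.sqrt (Fintype.card n) with hd
  have hsq : ∀ X ∈ S, ∀ Y ∈ S, |c * ‖X‖ ^ 2 - c * ‖Y‖ ^ 2|
      ≤ 2 * k ^ 2 * (κ ^ k / κ) * d * ‖X - Y‖ := by
    intro X hX Y hY
    have h1 := (hbound X hX).norm_le
    have h2 := (hbound Y hY).norm_le
    have h3 := abs_norm_sub_norm_le X Y
    have h4 : c * ‖X‖ ^ 2 - c * ‖Y‖ ^ 2 = c * ((‖X‖ + ‖Y‖) * (‖X‖ - ‖Y‖)) := by ring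
    rw [h4, abs_mul c, abs_mul (‖X‖ + ‖Y‖), abs_of_nonneg hc0,
      abs_of_nonneg (by positivity : 0 ≤ ‖X‖ + ‖Y‖)]
    calc c * ((‖X‖ + ‖Y‖) * |‖X‖ - ‖Y‖|) ≤ c * ((d * κ + d * κ) * ‖X - Y‖) := by gcongr
      _ = _ := by rw [hc]; field_simp; ring
  have hconv : ConvexOn ℝ S fun X => c * ‖X‖ ^ 2 := by
    refine ⟨hS, fun X _ Y _ a b ha hb hab => ?_⟩
    have h1 := norm_sq_jensen_gap X Y hab
    have h2 : 0 ≤ c * (a * b * ‖X - Y‖ ^ 2) := by positivity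
    rw [← h1] at h2
    simp only [smul_eq_mul]
    linarith
  refine ⟨fun X => f (X ^ k) + c * ‖X‖ ^ 2, fun X => c * ‖X‖ ^ 2, ⟨hS, ?_⟩, hconv, ?_, ?_, ?_⟩
  · intro X hX Y hY a b ha hb hab
    have h1 := norm_sq_jensen_gap X Y hab
    have h2 := (hbound X hX).jensen_gap_le hκ (hbound Y hY) ha hb hab
      (hbound _ (hS hX hY ha hb hab)) k f 1 zero_le_one (by simpa using hf)
    have h3 := (abs_le.mp h2).1
    rw [one_mul, ← hc, ← h1] at h3
    simp only [map_add, map_sub, map_smul, smul_eq_mul] at h3 ⊢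
    linarith
  · intro X hX Y hY
    have h1 := hsq X hX Y hY
    have h2 : |f (X ^ k) - f (Y ^ k)| ≤ k ^ 2 * (κ ^ k / κ) * d * ‖X - Y‖ := by
      -- The identity is inserted as second factor to use `hf`; its Frobenius norm is the source of
      -- the square root of the dimension.
      rw [← map_sub, ← mul_one (X ^ k - Y ^ k)]
      refine (hf _ _).trans ?_
      rw [norm_one_eq_sqrt_card, ← hd]
      have h3 := (hbound X hX).norm_pow_sub_pow_le hκ (hbound Y hY) k
      have h4 : (k : ℝ) ≤ k ^ 2 := by
        exact_mod_cast Nat.le_self_pow two_ne_zero k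
      calc ‖X ^ k - Y ^ k‖ * d ≤ (k * (κ ^ k / κ) * ‖X - Y‖) * d := by gcongr
        _ ≤ (k ^ 2 * (κ ^ k / κ) * ‖X - Y‖) * d := by gcongr
        _ = _ := by ring
    have h5 : f (X ^ k) + c * ‖X‖ ^ 2 - (f (Y ^ k) + c * ‖Y‖ ^ 2)
        = (f (X ^ k) - f (Y ^ k)) + (c * ‖X‖ ^ 2 - c * ‖Y‖ ^ 2) := by ring
    simp only [h5]
    refine (abs_add_le _ _).trans ((add_le_add h2 h1).trans (le_of_eq ?_))
    ring
  · intro X hX Y hY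
    refine (hsq X hX Y hY).trans ?_
    gcongr
    norm_num
  · intro X
    ring

end Frobenius

/-! ### Spectral balls. -/

section SpectralNorm

open scoped Matrix.Norms.L2Operator

variable {p n : ℕ}

theorem spectralNorm_eq_norm (X : Matrix (Fin p) (Fin n) ℝ) : spectralNorm X = ‖X‖ := rfl

theorem continuous_spectralNorm :
    Continuous (spectralNorm : Matrix (Fin p) (Fin n) ℝ → ℝ) :=
  continuous_norm

theorem convex_spectralNorm_lt (κ : ℝ) :
    Convex ℝ {X : Matrix (Fin p) (Fin n) ℝ | spectralNorm X < κ} := by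
  have h : {X : Matrix (Fin p) (Fin n) ℝ | spectralNorm X < κ} = Metric.ball 0 κ := by
    ext X
    simp [spectralNorm_eq_norm]
  rw [h]
  exact convex_ball 0 κ

theorem isCompact_spectralNorm_le (κ : ℝ) :
    IsCompact {X : Matrix (Fin p) (Fin n) ℝ | spectralNorm X ≤ κ} := by
  have : ProperSpace (Matrix (Fin p) (Fin n) ℝ) := FiniteDimensional.proper ℝ _
  have h : {X : Matrix (Fin p) (Fin n) ℝ | spectralNorm X ≤ κ} = Metric.closedBall 0 κ := by
    ext X
    simp [spectralNorm_eq_norm]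
  rw [h]
  exact isCompact_closedBall 0 κ

theorem spectralNorm_zero : spectralNorm (0 : Matrix (Fin p) (Fin n) ℝ) = 0 := by
  rw [spectralNorm_eq_norm, norm_zero]

theorem spectralNorm_nonneg (X : Matrix (Fin p) (Fin n) ℝ) : 0 ≤ spectralNorm X := by
  rw [spectralNorm_eq_norm]
  exact norm_nonneg X

theorem spectralNorm_transpose (X : Matrix (Fin p) (Fin n) ℝ) :
    spectralNorm X.transpose = spectralNorm X := by
  rw [spectralNorm_eq_norm, spectralNorm_eq_norm, ← Matrix.l2_opNorm_conjTranspose X,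
    Matrix.conjTranspose_eq_transpose_of_trivial]

theorem sum_mulVec_sq_le (X : Matrix (Fin p) (Fin n) ℝ) (v : Fin n → ℝ) :
    ∑ i, (X.mulVec v) i ^ 2 ≤ spectralNorm X ^ 2 * ∑ j, v j ^ 2 := by
  have h := Matrix.l2_opNorm_mulVec X (WithLp.toLp 2 v)
  have h2 := pow_le_pow_left₀ (norm_nonneg _) h 2
  rw [mul_pow, EuclideanSpace.norm_sq_eq, EuclideanSpace.norm_sq_eq] at h2
  simpa [spectralNorm_eq_norm] using h2

end SpectralNorm

/-! ### Nuclear norm of rank-one matrices. -/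

section NuclearNorm

variable {p n : ℕ}

theorem dotProduct_self_nonneg {m : Type*} [Fintype m] (v : m → ℝ) : 0 ≤ v ⬝ᵥ v :=
  Finset.sum_nonneg fun i _ => mul_self_nonneg (v i)

theorem nuclearNorm_vecMulVec (u : Fin p → ℝ) (v : Fin n → ℝ) :
    nuclearNorm (Matrix.vecMulVec u v) = Real.sqrt (u ⬝ᵥ u) * Real.sqrt (v ⬝ᵥ v) := by
  set a := Real.sqrt (u ⬝ᵥ u) with ha
  set b := Real.sqrt (v ⬝ᵥ v) with hb
  have hu : 0 ≤ u ⬝ᵥ u := dotProduct_self_nonneg u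
  have hv : 0 ≤ v ⬝ᵥ v := dotProduct_self_nonneg v
  have ha2 : u ⬝ᵥ u = a ^ 2 := (Real.sq_sqrt hu).symm
  have hb2 : v ⬝ᵥ v = b ^ 2 := (Real.sq_sqrt hv).symm
  -- The positive square root of `b² u uᵀ`, since `(u uᵀ)² = a² u uᵀ`. If `a = 0` then `u = 0`, and
  -- the default value of `b / 0` does no harm.
  set W : Matrix (Fin p) (Fin p) ℝ := (b / a) • Matrix.vecMulVec u u with hW
  have hWpos : W.PosSemidef := by
    have := Matrix.posSemidef_vecMulVec_self_star u
    rw [star_trivial] at this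
    exact this.smul (by positivity)
  have hsq : Matrix.vecMulVec u v * (Matrix.vecMulVec u v).transpose = W ^ 2 := by
    rw [Matrix.transpose_vecMulVec, Matrix.vecMulVec_mul_vecMulVec, sq, hW, Matrix.smul_mul,
      Matrix.mul_smul, Matrix.vecMulVec_mul_vecMulVec, hb2, ha2, Matrix.vecMulVec_smul,
      Matrix.vecMulVec_smul, smul_smul, smul_smul]
    by_cases h0 : a = 0
    · have : u = 0 := dotProduct_self_eq_zero.mp (by rw [ha2, h0]; simp)
      simp [this]
    · congr 1
      field_simp
  have hcfc : cfc Real.sqrt (W ^ 2) = W := by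
    have hsa : IsSelfAdjoint W := hWpos.1
    rw [← cfc_comp_pow Real.sqrt 2 W Real.continuous_sqrt.continuousOn hsa]
    conv_rhs => rw [← cfc_id ℝ W hsa]
    refine cfc_congr fun x hx => ?_
    have hx0 : 0 ≤ x := (Matrix.posSemidef_iff_isHermitian_and_spectrum_nonneg.mp hWpos).2 hx
    simp [Real.sqrt_sq hx0]
  rw [nuclearNorm, hsq, hcfc, hW, Matrix.trace_smul, Matrix.trace_vecMulVec, ha2, smul_eq_mul]
  by_cases h0 : a = 0
  · simp [h0]
  · field_simp

end NuclearNorm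

/-! ### Convex decompositions of powers, square and rectangular. -/

section Decomposition

open scoped Matrix.Norms.Frobenius

variable {p n : ℕ} {κ : ℝ}

/-- A linear form dominated by the nuclear norm is dominated by products of Frobenius norms on
products of matrices. -/
theorem abs_apply_mul_le_of_le_nuclearNorm {l : Type*} [Fintype l]
    {f : Matrix (Fin p) (Fin n) ℝ →ₗ[ℝ] ℝ} (hf : ∀ M, |f M| ≤ nuclearNorm M)
    (P : Matrix (Fin p) l ℝ) (Q : Matrix l (Fin n) ℝ) : |f (P * Q)| ≤ ‖P‖ * ‖Q‖ := by
  -- Columns of `P` times rows of `Q`: the nuclear norm of each term is a product of Euclidean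
  -- norms, and Cauchy–Schwarz over `k` rebuilds the Frobenius norms.
  have h : P * Q = ∑ k, Matrix.vecMulVec (fun i => P i k) (Q k) := by
    ext i j
    simp [Matrix.mul_apply, Matrix.sum_apply, Matrix.vecMulVec_apply]
  have hP : ‖P‖ = Real.sqrt (∑ k, Real.sqrt ((fun i => P i k) ⬝ᵥ fun i => P i k) ^ 2) := by
    rw [← Real.sqrt_sq (norm_nonneg P), norm_sq_eq_sum, Finset.sum_comm]
    congr 1
    refine Finset.sum_congr rfl fun k _ => ?_
    rw [Real.sq_sqrt (dotProduct_self_nonneg _)]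
    simp [dotProduct, sq]
  have hQ : ‖Q‖ = Real.sqrt (∑ k, Real.sqrt (Q k ⬝ᵥ Q k) ^ 2) := by
    rw [← Real.sqrt_sq (norm_nonneg Q), norm_sq_eq_sum]
    congr 1
    refine Finset.sum_congr rfl fun k _ => ?_
    rw [Real.sq_sqrt (dotProduct_self_nonneg _)]
    simp [dotProduct, sq]
  rw [h, map_sum, hP, hQ]
  refine (Finset.abs_sum_le_sum_abs _ _).trans ?_
  refine le_trans ?_ (Real.sum_mul_le_sqrt_mul_sqrt Finset.univ _ _)
  exact Finset.sum_le_sum fun k _ => (hf _).trans (nuclearNorm_vecMulVec _ _).le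

theorem norm_mul_sq_le_spectralNorm {l : Type*} [Fintype l] (X : Matrix (Fin p) (Fin n) ℝ)
    (P : Matrix (Fin n) l ℝ) : ‖X * P‖ ^ 2 ≤ spectralNorm X ^ 2 * ‖P‖ ^ 2 := by
  rw [norm_sq_eq_sum, norm_sq_eq_sum, Finset.sum_comm,
    Finset.sum_comm (f := fun i j => P i j ^ 2), Finset.mul_sum]
  refine Finset.sum_le_sum fun j _ => ?_
  exact sum_mulVec_sq_le X fun i => P i j

theorem norm_mul_le_spectralNorm {l : Type*} [Fintype l] (X : Matrix (Fin p) (Fin n) ℝ)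
    (P : Matrix (Fin n) l ℝ) : ‖X * P‖ ≤ spectralNorm X * ‖P‖ := by
  refine le_of_sq_le_sq ?_ (mul_nonneg (spectralNorm_nonneg X) (norm_nonneg P))
  rw [mul_pow]
  exact norm_mul_sq_le_spectralNorm X P

theorem mulBounded_of_spectralNorm_le {X : Matrix (Fin p) (Fin p) ℝ} (hX : spectralNorm X ≤ κ) :
    MulBounded κ X := by
  intro P
  refine ⟨(norm_mul_le_spectralNorm X P).trans (by gcongr), ?_⟩
  rw [← Matrix.frobenius_norm_transpose, Matrix.transpose_mul, ← Matrix.frobenius_norm_transpose P]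
  refine (norm_mul_le_spectralNorm _ _).trans ?_
  rw [spectralNorm_transpose]
  gcongr

/-- The function `g` is, on the open spectral ball of radius `κ`, the difference of two convex
functions that are `L`-Lipschitz for the Frobenius norm. -/
def HasConvexDecomposition (κ L : ℝ) (g : Matrix (Fin p) (Fin n) ℝ → ℝ) : Prop :=
  ∃ h₁ h₂ : Matrix (Fin p) (Fin n) ℝ → ℝ,
    ConvexOn ℝ Set.univ h₁ ∧ ConvexOn ℝ Set.univ h₂ ∧
    (∀ X Y, |h₁ X - h₁ Y| ≤ L * frobeniusNorm (X - Y)) ∧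
    (∀ X Y, |h₂ X - h₂ Y| ≤ L * frobeniusNorm (X - Y)) ∧
    ∀ X, spectralNorm X < κ → g X = h₁ X - h₂ X

theorem HasConvexDecomposition.mono {L L' : ℝ} {g : Matrix (Fin p) (Fin n) ℝ → ℝ}
    (h : HasConvexDecomposition κ L g) (hL : L ≤ L') : HasConvexDecomposition κ L' g := by
  obtain ⟨h₁, h₂, c₁, c₂, l₁, l₂, e⟩ := h
  have hle : ∀ X : Matrix (Fin p) (Fin n) ℝ, L * frobeniusNorm X ≤ L' * frobeniusNorm X :=
    fun X => mul_le_mul_of_nonneg_right hL (Real.sqrt_nonneg _)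
  exact ⟨h₁, h₂, c₁, c₂, fun X Y => (l₁ X Y).trans (hle _), fun X Y => (l₂ X Y).trans (hle _), e⟩

theorem hasConvexDecomposition_of_convexOn (hκ : 0 < κ) {L : ℝ} (hL : 0 ≤ L)
    {g h₁ h₂ : Matrix (Fin p) (Fin n) ℝ → ℝ}
    (c₁ : ConvexOn ℝ {X | spectralNorm X < κ} h₁) (c₂ : ConvexOn ℝ {X | spectralNorm X < κ} h₂)
    (l₁ : ∀ X, spectralNorm X < κ → ∀ Y, spectralNorm Y < κ → |h₁ X - h₁ Y| ≤ L * ‖X - Y‖)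
    (l₂ : ∀ X, spectralNorm X < κ → ∀ Y, spectralNorm Y < κ → |h₂ X - h₂ Y| ≤ L * ‖X - Y‖)
    (hg : ∀ X, spectralNorm X < κ → g X = h₁ X - h₂ X) : HasConvexDecomposition κ L g := by
  have hne : {X : Matrix (Fin p) (Fin n) ℝ | spectralNorm X < κ}.Nonempty :=
    ⟨0, by simpa [spectralNorm_zero] using hκ⟩
  obtain ⟨g₁, d₁, m₁, e₁⟩ := exists_convex_lipschitz_extension hne c₁ hL l₁
  obtain ⟨g₂, d₂, m₂, e₂⟩ := exists_convex_lipschitz_extension hne c₂ hL l₂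
  refine ⟨g₁, g₂, d₁, d₂, ?_, ?_, fun X hX => ?_⟩
  · simpa only [frobeniusNorm_eq_norm] using m₁
  · simpa only [frobeniusNorm_eq_norm] using m₂
  · rw [e₁ X hX, e₂ X hX, hg X hX]

/-- The quadratic growth in the degree is absorbed by the base `2e`. -/
theorem three_mul_sq_mul_le_zpow (hκ : 0 < κ) (k : ℕ) :
    3 * (k : ℝ) ^ 2 * (κ ^ k / κ) ≤ 12 * (2 * Real.exp 1 * κ) ^ ((k : ℤ) - 1) := by
  cases k with
  | zero => simp only [Nat.cast_zero]; norm_num; positivity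
  | succ j =>
    -- This `4` times the leading `3` gives the constant `12`; the base `2` alone already suffices.
    have h1 : ∀ j : ℕ, (j + 1) ^ 2 ≤ 4 * 2 ^ j := by
      intro j
      induction j with
      | zero => norm_num
      | succ j ih =>
        rcases Nat.lt_or_ge j 2 with hj | hj
        · interval_cases j <;> norm_num
        · rw [pow_succ 2 j]
          nlinarith
    have h2 : ((j + 1 : ℕ) : ℝ) ^ 2 ≤ 4 * 2 ^ j := by exact_mod_cast h1 j
    have h3 : (2 : ℝ) ^ j ≤ (2 * Real.exp 1) ^ j := by
      have := Real.add_one_le_exp (1 : ℝ)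
      gcongr
      linarith
    have h4 : κ ^ (j + 1) / κ = κ ^ j := by rw [pow_succ]; field_simp
    have h5 : ((j + 1 : ℕ) : ℤ) - 1 = (j : ℕ) := by push_cast; ring
    rw [h4, h5, zpow_natCast, mul_pow (2 * Real.exp 1) κ j, ← mul_assoc]
    refine mul_le_mul_of_nonneg_right ?_ (by positivity)
    linarith

theorem hasConvexDecomposition_pow (hκ : 0 < κ) {f : Matrix (Fin p) (Fin p) ℝ →ₗ[ℝ] ℝ}
    (hf : ∀ M, |f M| ≤ nuclearNorm M) (k : ℕ) :
    HasConvexDecomposition κ (12 * (Real.sqrt p * (2 * Real.exp 1 * κ) ^ ((k : ℤ) - 1)))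
      fun X => f (X ^ k) := by
  obtain ⟨h₁, h₂, c₁, c₂, l₁, l₂, e⟩ := exists_convex_decomposition_pow hκ
    (convex_spectralNorm_lt κ) (fun X hX => mulBounded_of_spectralNorm_le (le_of_lt hX))
    (abs_apply_mul_le_of_le_nuclearNorm hf) k
  refine (hasConvexDecomposition_of_convexOn hκ (by positivity) c₁ c₂ l₁ l₂
    fun X _ => e X).mono ?_
  rw [Fintype.card_fin]
  refine (mul_le_mul_of_nonneg_right (three_mul_sq_mul_le_zpow hκ k)
    (Real.sqrt_nonneg _)).trans (le_of_eq ?_)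
  ring

/-- The symmetric dilation of a rectangular matrix. -/
def dilation : Matrix (Fin p) (Fin n) ℝ →ₗ[ℝ] Matrix (Fin p ⊕ Fin n) (Fin p ⊕ Fin n) ℝ where
  toFun X := Matrix.fromBlocks 0 X X.transpose 0
  map_add' X Y := by simp [Matrix.fromBlocks_add]
  map_smul' c X := by simp [Matrix.fromBlocks_smul]

theorem dilation_apply (X : Matrix (Fin p) (Fin n) ℝ) :
    dilation X = Matrix.fromBlocks 0 X X.transpose 0 := rfl

theorem transpose_dilation (X : Matrix (Fin p) (Fin n) ℝ) :
    (dilation X).transpose = dilation X := by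
  simp [dilation_apply, Matrix.fromBlocks_transpose]

theorem norm_dilation_le (X : Matrix (Fin p) (Fin n) ℝ) : ‖dilation X‖ ≤ 2 * ‖X‖ := by
  refine le_of_sq_le_sq ?_ (by positivity)
  have h : ‖dilation X‖ ^ 2 = ‖X‖ ^ 2 + ‖X.transpose‖ ^ 2 := by
    simp only [norm_sq_eq_sum, Fintype.sum_sum_type, dilation_apply]
    simp
  rw [h, Matrix.frobenius_norm_transpose]
  nlinarith [sq_nonneg ‖X‖]

theorem norm_dilation_mul_le {X : Matrix (Fin p) (Fin n) ℝ} (hX : spectralNorm X ≤ κ)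
    (P : Matrix (Fin p ⊕ Fin n) (Fin p ⊕ Fin n) ℝ) : ‖dilation X * P‖ ≤ κ * ‖P‖ := by
  have hκ : 0 ≤ κ := (spectralNorm_nonneg X).trans hX
  refine le_of_sq_le_sq ?_ (by positivity)
  have h1 : ‖dilation X * P‖ ^ 2
      = ‖X * P.submatrix Sum.inr id‖ ^ 2 + ‖X.transpose * P.submatrix Sum.inl id‖ ^ 2 := by
    simp only [norm_sq_eq_sum, Fintype.sum_sum_type, dilation_apply, Matrix.mul_apply]
    simp
  have h2 : ‖P‖ ^ 2 = ‖P.submatrix Sum.inl id‖ ^ 2 + ‖P.submatrix Sum.inr id‖ ^ 2 := by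
    simp only [norm_sq_eq_sum, Fintype.sum_sum_type]
    simp
  have h3 := norm_mul_sq_le_spectralNorm X (P.submatrix Sum.inr id)
  have h4 := norm_mul_sq_le_spectralNorm X.transpose (P.submatrix Sum.inl id)
  have h5 : spectralNorm X ^ 2 ≤ κ ^ 2 := pow_le_pow_left₀ (spectralNorm_nonneg X) hX 2
  rw [spectralNorm_transpose] at h4
  rw [h1, mul_pow, h2]
  nlinarith [mul_le_mul_of_nonneg_right h5 (sq_nonneg ‖P.submatrix Sum.inr id‖),
    mul_le_mul_of_nonneg_right h5 (sq_nonneg ‖P.submatrix Sum.inl id‖)]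

theorem mulBounded_dilation {X : Matrix (Fin p) (Fin n) ℝ} (hX : spectralNorm X ≤ κ) :
    MulBounded κ (dilation X) := by
  intro P
  refine ⟨norm_dilation_mul_le hX P, ?_⟩
  rw [← Matrix.frobenius_norm_transpose, Matrix.transpose_mul, transpose_dilation,
    ← Matrix.frobenius_norm_transpose P]
  exact norm_dilation_mul_le hX _

theorem sum_comp_le_sum_of_injective {m m' : Type*} [Fintype m] [Fintype m'] {e : m' → m}
    (he : e.Injective) {g : m → ℝ} (hg : ∀ i, 0 ≤ g i) : ∑ i, g (e i) ≤ ∑ i, g i := by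
  have h := Finset.sum_map Finset.univ (⟨e, he⟩ : m' ↪ m) g
  simp only [Function.Embedding.coeFn_mk] at h
  rw [← h]
  exact Finset.sum_le_univ_sum_of_nonneg hg

theorem norm_submatrix_le {l m l' m' : Type*} [Fintype l] [Fintype m] [Fintype l'] [Fintype m']
    (M : Matrix l m ℝ) {r : l' → l} {c : m' → m} (hr : r.Injective) (hc : c.Injective) :
    ‖M.submatrix r c‖ ≤ ‖M‖ := by
  refine le_of_sq_le_sq ?_ (norm_nonneg M)
  simp only [norm_sq_eq_sum, Matrix.submatrix_apply]
  have h1 : ∀ i, ∑ j, M (r i) (c j) ^ 2 ≤ ∑ j, M (r i) j ^ 2 := fun i =>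
    sum_comp_le_sum_of_injective hc (fun j => sq_nonneg (M (r i) j))
  exact (Finset.sum_le_sum fun i _ => h1 i).trans (sum_comp_le_sum_of_injective hr
    fun i => Finset.sum_nonneg fun j _ => sq_nonneg (M i j))

/-- Extracting a block of `P * Q` only selects rows of `P` and columns of `Q`, so `f` composed with
the extraction keeps the product bound. The square argument then runs on the image of the spectral
ball under the dilation, with a further factor `2` from `norm_dilation_le`. -/
theorem hasConvexDecomposition_submatrix_dilation_pow {p' n' : ℕ} (hκ : 0 < κ)
    {f : Matrix (Fin p') (Fin n') ℝ →ₗ[ℝ] ℝ} (hf : ∀ M, |f M| ≤ nuclearNorm M)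
    {r : Fin p' → Fin p ⊕ Fin n} {c : Fin n' → Fin p ⊕ Fin n} (hr : r.Injective)
    (hc : c.Injective) (k : ℕ) :
    HasConvexDecomposition κ
      (24 * (Real.sqrt ((p : ℝ) + n) * (2 * Real.exp 1 * κ) ^ ((k : ℤ) - 1)))
      fun X : Matrix (Fin p) (Fin n) ℝ => f ((dilation X ^ k).submatrix r c) := by
  let F : Matrix (Fin p ⊕ Fin n) (Fin p ⊕ Fin n) ℝ →ₗ[ℝ] ℝ :=
    f ∘ₗ { toFun := fun M => M.submatrix r c, map_add' := fun _ _ => rfl,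
           map_smul' := fun _ _ => rfl }
  have hF : ∀ P Q, |F (P * Q)| ≤ ‖P‖ * ‖Q‖ := by
    intro P Q
    have h : F (P * Q) = f (P.submatrix r id * Q.submatrix id c) :=
      congrArg f (Matrix.submatrix_mul P Q r id c Function.bijective_id)
    rw [h]
    refine (abs_apply_mul_le_of_le_nuclearNorm hf _ _).trans ?_
    exact mul_le_mul (norm_submatrix_le P hr Function.injective_id)
      (norm_submatrix_le Q Function.injective_id hc) (norm_nonneg _) (norm_nonneg _)
  set S : Set (Matrix (Fin p) (Fin n) ℝ) := {X | spectralNorm X < κ} with hS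
  obtain ⟨h₁, h₂, c₁, c₂, l₁, l₂, e⟩ := exists_convex_decomposition_pow hκ
    ((convex_spectralNorm_lt κ).linear_image (dilation (p := p) (n := n)))
    (by rintro _ ⟨X, hX, rfl⟩; exact mulBounded_dilation (le_of_lt hX)) hF k
  have hlip : ∀ h : Matrix (Fin p ⊕ Fin n) (Fin p ⊕ Fin n) ℝ → ℝ,
      (∀ X ∈ dilation '' S, ∀ Y ∈ dilation '' S, |h X - h Y| ≤ 3 * k ^ 2 * (κ ^ k / κ) *
        Real.sqrt (Fintype.card (Fin p ⊕ Fin n)) * ‖X - Y‖) →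
      ∀ X, spectralNorm X < κ → ∀ Y, spectralNorm Y < κ →
        |h (dilation X) - h (dilation Y)| ≤ 2 * (3 * k ^ 2 * (κ ^ k / κ) *
          Real.sqrt ((p : ℝ) + n)) * ‖X - Y‖ := by
    intro h hh X hX Y hY
    refine (hh _ ⟨X, hX, rfl⟩ _ ⟨Y, hY, rfl⟩).trans ?_
    have h1 := norm_dilation_le (X - Y)
    rw [map_sub] at h1
    rw [Fintype.card_sum, Fintype.card_fin, Fintype.card_fin, Nat.cast_add]
    refine (mul_le_mul_of_nonneg_left h1 (by positivity)).trans (le_of_eq ?_)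
    ring
  have hpre : ∀ h : Matrix (Fin p ⊕ Fin n) (Fin p ⊕ Fin n) ℝ → ℝ, ConvexOn ℝ (dilation '' S) h →
      ConvexOn ℝ S fun X => h (dilation X) := fun h hh =>
    (hh.comp_linearMap dilation).subset (Set.subset_preimage_image _ _)
      (convex_spectralNorm_lt κ)
  refine (hasConvexDecomposition_of_convexOn hκ (by positivity) (hpre _ c₁) (hpre _ c₂)
    (hlip _ l₁) (hlip _ l₂) fun X _ => e (dilation X)).mono ?_
  refine (mul_le_mul_of_nonneg_left (mul_le_mul_of_nonneg_right (three_mul_sq_mul_le_zpow hκ k)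
    (Real.sqrt_nonneg _)) zero_le_two).trans (le_of_eq ?_)
  ring

theorem dilation_pow_two_mul (X : Matrix (Fin p) (Fin n) ℝ) (m : ℕ) :
    dilation X ^ (2 * m)
      = Matrix.fromBlocks ((X * X.transpose) ^ m) 0 0 ((X.transpose * X) ^ m) := by
  rw [pow_mul]
  have h : dilation X ^ 2 = Matrix.fromBlocks (X * X.transpose) 0 0 (X.transpose * X) := by
    rw [sq, dilation_apply, Matrix.fromBlocks_multiply]
    simp
  rw [h]
  induction m with
  | zero => simp [Matrix.fromBlocks_one]
  | succ m ih =>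
    rw [pow_succ, ih, Matrix.fromBlocks_multiply]
    simp [pow_succ]

theorem dilation_pow_two_mul_add_one (X : Matrix (Fin p) (Fin n) ℝ) (m : ℕ) :
    dilation X ^ (2 * m + 1)
      = Matrix.fromBlocks 0 ((X * X.transpose) ^ m * X)
          ((X.transpose * X) ^ m * X.transpose) 0 := by
  rw [pow_succ, dilation_pow_two_mul, dilation_apply, Matrix.fromBlocks_multiply]
  simp

theorem hasConvexDecomposition_gram_pow (hκ : 0 < κ) {f : Matrix (Fin p) (Fin p) ℝ →ₗ[ℝ] ℝ}
    (hf : ∀ M, |f M| ≤ nuclearNorm M) (m : ℕ) :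
    HasConvexDecomposition κ
      (24 * (Real.sqrt ((p : ℝ) + n) * (2 * Real.exp 1 * κ) ^ (2 * (m : ℤ) - 1)))
      fun X : Matrix (Fin p) (Fin n) ℝ => f ((X * X.transpose) ^ m) := by
  have h := hasConvexDecomposition_submatrix_dilation_pow (p := p) (n := n) hκ hf
    Sum.inl_injective Sum.inl_injective (2 * m)
  simp only [dilation_pow_two_mul] at h
  push_cast at h
  exact h

theorem hasConvexDecomposition_gram_pow_mul (hκ : 0 < κ)
    {f : Matrix (Fin p) (Fin n) ℝ →ₗ[ℝ] ℝ} (hf : ∀ M, |f M| ≤ nuclearNorm M) (m : ℕ) :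
    HasConvexDecomposition κ
      (24 * (Real.sqrt ((p : ℝ) + n) * (2 * Real.exp 1 * κ) ^ (2 * m)))
      fun X : Matrix (Fin p) (Fin n) ℝ => f ((X * X.transpose) ^ m * X) := by
  have h := hasConvexDecomposition_submatrix_dilation_pow (p := p) (n := n) hκ hf
    Sum.inl_injective Sum.inr_injective (2 * m + 1)
  simp only [dilation_pow_two_mul_add_one] at h
  have h5 : ((2 * m + 1 : ℕ) : ℤ) - 1 = (2 * m : ℕ) := by push_cast; ring
  rw [h5, zpow_natCast] at h
  exact h

end Decomposition

/-! ### Exponential tails: from an arbitrary center to the mean. -/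

section Tails

variable {Ω : Type*} [MeasurableSpace Ω]

theorem cond_real_mul_eq_inter (μ : Measure Ω) [IsFiniteMeasure μ] {s : Set Ω}
    (hs : MeasurableSet s) (t : Set Ω) : (cond μ s).real t * μ.real s = μ.real (s ∩ t) := by
  rw [measureReal_def, measureReal_def, measureReal_def, ← ENNReal.toReal_mul,
    cond_mul_eq_inter hs t μ]

theorem integrableOn_exp_neg_div_rpow {q s : ℝ} (hq : 0 < q) (hs : 0 < s) :
    IntegrableOn (fun t : ℝ => Real.exp (-(t / s) ^ q)) (Set.Ioi 0) := by
  have h := integrableOn_rpow_mul_exp_neg_rpow (p := q) (s := 0) (by norm_num) hq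
  simp only [Real.rpow_zero, one_mul] at h
  have h2 := (integrableOn_Ioi_comp_mul_left_iff (fun t : ℝ => Real.exp (-t ^ q)) 0
    (inv_pos.mpr hs)).mpr (by simpa using h)
  simpa [div_eq_inv_mul] using h2

theorem integral_exp_neg_div_rpow {q s : ℝ} (hq : 0 < q) (hs : 0 < s) :
    ∫ t in Set.Ioi (0 : ℝ), Real.exp (-(t / s) ^ q) = s * Real.Gamma (1 / q + 1) := by
  have h := integral_comp_mul_left_Ioi (fun t : ℝ => Real.exp (-t ^ q)) 0 (inv_pos.mpr hs)
  simp only [mul_zero, integral_exp_neg_rpow hq, inv_inv, smul_eq_mul] at h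
  simpa only [div_eq_inv_mul] using h

/-- Exponential concentration around a constant implies that the mean is close to it. -/
theorem abs_integral_sub_le {ν : Measure Ω} [IsProbabilityMeasure ν] {Y : Ω → ℝ}
    (hY : Integrable Y ν) {C s q a : ℝ} (hq : 0 < q) (hs : 0 < s)
    (h : ∀ t, 0 < t → ν.real {ω | t ≤ |Y ω - a|} ≤ C * Real.exp (-(t / s) ^ q)) :
    |∫ ω, Y ω ∂ν - a| ≤ C * Real.Gamma (1 / q + 1) * s := by
  have hYa : Integrable (fun ω => Y ω - a) ν := hY.sub (integrable_const a)
  have h1 : ∫ ω, Y ω ∂ν - a = ∫ ω, (Y ω - a) ∂ν := by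
    rw [integral_sub hY (integrable_const a)]
    simp
  rw [h1]
  refine (abs_integral_le_integral_abs).trans ?_
  -- Layer-cake formula: integrating the tail bound produces the Gamma factor.
  rw [hYa.abs.integral_eq_integral_meas_le (Filter.Eventually.of_forall fun _ => abs_nonneg _)]
  refine (integral_mono_of_nonneg (Filter.Eventually.of_forall fun _ => measureReal_nonneg)
    ((integrableOn_exp_neg_div_rpow hq hs).const_mul C) ?_).trans (le_of_eq ?_)
  · filter_upwards [ae_restrict_mem measurableSet_Ioi] with t ht using h t ht
  · rw [integral_const_mul, integral_exp_neg_div_rpow hq hs]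
    ring

/-- Exponential concentration around a constant implies concentration around the mean. -/
theorem tail_around_integral {ν : Measure Ω} [IsProbabilityMeasure ν] {Y : Ω → ℝ}
    (hY : Integrable Y ν) {C s q a : ℝ} (hC : 0 < C) (hq : 0 < q) (hs : 0 < s)
    (h : ∀ t, 0 < t → ν.real {ω | t ≤ |Y ω - a|} ≤ C * Real.exp (-(t / s) ^ q))
    {t : ℝ} (ht : 0 < t) :
    ν.real {ω | t ≤ |Y ω - ∫ ω', Y ω' ∂ν|}
      ≤ (C + Real.exp ((C * Real.Gamma (1 / q + 1)) ^ q)) * Real.exp (-(t / (2 * s)) ^ q) := by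
  set M := C * Real.Gamma (1 / q + 1) with hM
  have hmean : |∫ ω, Y ω ∂ν - a| ≤ M * s := abs_integral_sub_le hY hq hs h
  rw [add_mul]
  -- For small `t` the added prefactor `exp (M ^ q)` makes the bound at least one; for large `t` the
  -- shift of center costs at most `t / 2`.
  rcases le_or_gt t (2 * (M * s)) with htM | htM
  · have h1 : (t / (2 * s)) ^ q ≤ M ^ q := by
      refine Real.rpow_le_rpow (by positivity) ?_ hq.le
      rw [div_le_iff₀ (by positivity)]
      linarith
    have h2 : 1 ≤ Real.exp (M ^ q) * Real.exp (-(t / (2 * s)) ^ q) := by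
      rw [← Real.exp_add, Real.one_le_exp_iff]
      linarith
    have h3 : ν.real {ω | t ≤ |Y ω - ∫ ω', Y ω' ∂ν|} ≤ 1 := measureReal_le_one
    have h4 : 0 ≤ C * Real.exp (-(t / (2 * s)) ^ q) := by positivity
    linarith
  · have h1 : {ω | t ≤ |Y ω - ∫ ω', Y ω' ∂ν|} ⊆ {ω | t / 2 ≤ |Y ω - a|} := by
      intro ω hω
      simp only [Set.mem_ofPred_eq] at hω ⊢
      have h2 := abs_sub_le (Y ω) a (∫ ω', Y ω' ∂ν)
      rw [abs_sub_comm a] at h2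
      linarith
    have h2 := (measureReal_mono h1).trans (h (t / 2) (by positivity))
    rw [div_div] at h2
    have h3 : 0 ≤ Real.exp (M ^ q) * Real.exp (-(t / (2 * s)) ^ q) := by positivity
    linarith

end Tails

/-! ### A single random matrix. -/

section Single

variable {Ω : Type*} [MeasurableSpace Ω] {p n p' n' : ℕ} {X : Ω → Matrix (Fin p) (Fin n) ℝ}
  {F : Matrix (Fin p) (Fin n) ℝ → Matrix (Fin p') (Fin n') ℝ}

theorem continuous_frobeniusNorm :
    Continuous (frobeniusNorm : Matrix (Fin p) (Fin n) ℝ → ℝ) := by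
  unfold frobeniusNorm
  fun_prop

theorem IsRandomMatrix.measurable_entries (hX : IsRandomMatrix X) :
    Measurable fun ω i j => X ω i j :=
  measurable_pi_iff.mpr fun i => measurable_pi_iff.mpr fun j => hX i j

theorem IsRandomMatrix.measurable_comp (hX : IsRandomMatrix X)
    {g : Matrix (Fin p) (Fin n) ℝ → ℝ} (hg : Continuous g) : Measurable fun ω => g (X ω) := by
  have hg' : Continuous fun x : Fin p → Fin n → ℝ => g (Matrix.of x) := hg
  exact hg'.measurable.comp hX.measurable_entries

theorem linearMap_apply_eq_sum (f : Matrix (Fin p) (Fin n) ℝ →ₗ[ℝ] ℝ)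
    (M : Matrix (Fin p) (Fin n) ℝ) :
    f M = ∑ i, ∑ j, M i j * f (Matrix.single i j 1) := by
  conv_lhs => rw [Matrix.matrix_eq_sum_single M]
  simp only [map_sum]
  refine Finset.sum_congr rfl fun i _ => Finset.sum_congr rfl fun j _ => ?_
  rw [← smul_eq_mul, ← map_smul, Matrix.smul_single, smul_eq_mul, mul_one]

theorem apply_matrixMean {ν : Measure Ω} {Z : Ω → Matrix (Fin p) (Fin n) ℝ}
    (hZ : ∀ i j, Integrable (fun ω => Z ω i j) ν) (f : Matrix (Fin p) (Fin n) ℝ →ₗ[ℝ] ℝ) :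
    Integrable (fun ω => f (Z ω)) ν ∧ f (matrixMean ν Z) = ∫ ω, f (Z ω) ∂ν := by
  have h1 : ∀ i j, Integrable (fun ω => Z ω i j * f (Matrix.single i j 1)) ν :=
    fun i j => (hZ i j).mul_const _
  have h2 : ∀ i, Integrable (fun ω => ∑ j, Z ω i j * f (Matrix.single i j 1)) ν :=
    fun i => integrable_finsetSum _ fun j _ => h1 i j
  rw [linearMap_apply_eq_sum f (matrixMean ν Z)]
  have h3 : (fun ω => f (Z ω)) = fun ω => ∑ i, ∑ j, Z ω i j * f (Matrix.single i j 1) :=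
    funext fun ω => linearMap_apply_eq_sum f (Z ω)
  rw [h3]
  refine ⟨integrable_finsetSum _ fun i _ => h2 i, ?_⟩
  rw [integral_finsetSum _ fun i _ => h2 i]
  refine Finset.sum_congr rfl fun i _ => ?_
  rw [integral_finsetSum _ fun j _ => h1 i j]
  refine Finset.sum_congr rfl fun j _ => ?_
  rw [integral_mul_const]
  rfl

/-- Factor `M` as `M * 1`. The bound does not depend on `f`, so one event can serve all forms at
once. -/
theorem abs_apply_le_of_le_nuclearNorm {f : Matrix (Fin p) (Fin n) ℝ →ₗ[ℝ] ℝ}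
    (hf : ∀ M, |f M| ≤ nuclearNorm M) (M : Matrix (Fin p) (Fin n) ℝ) :
    |f M| ≤ frobeniusNorm M * frobeniusNorm (1 : Matrix (Fin n) (Fin n) ℝ) := by
  have h := abs_apply_mul_le_of_le_nuclearNorm hf M 1
  rwa [Matrix.mul_one, ← frobeniusNorm_eq_norm, ← frobeniusNorm_eq_norm] at h

/-- A continuous function of a random matrix is, with positive probability, almost constant. -/
theorem exists_event_near_constant (μ : Measure Ω) [IsProbabilityMeasure μ]
    (hX : IsRandomMatrix X) (hF : Continuous F) {δ : ℝ} (hδ : 0 < δ) :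
    ∃ (A : Set Ω) (Z : Matrix (Fin p') (Fin n') ℝ), MeasurableSet A ∧ 0 < μ A ∧
      ∀ ω ∈ A, ∀ f : Matrix (Fin p') (Fin n') ℝ →ₗ[ℝ] ℝ, (∀ M, |f M| ≤ nuclearNorm M) →
        |f (F (X ω)) - f Z| < δ := by
  have hmeas := hX.measurable_entries
  have hprob : IsProbabilityMeasure (μ.map fun ω i j => X ω i j) :=
    Measure.isProbabilityMeasure_map hmeas.aemeasurable
  -- A point of the support of the law: each of its neighborhoods has positive mass.
  obtain ⟨x, -, hx⟩ := exists_mem_forall_mem_nhdsWithin_pos_measure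
    (μ := μ.map fun ω i j => X ω i j) (s := Set.univ) (by simp)
  let g : Matrix (Fin p) (Fin n) ℝ → ℝ := fun M =>
    frobeniusNorm (F M - F (Matrix.of x)) * frobeniusNorm (1 : Matrix (Fin n') (Fin n') ℝ)
  have hg : Continuous g :=
    (continuous_frobeniusNorm.comp (hF.sub continuous_const)).mul continuous_const
  have hg' : Continuous fun y : Fin p → Fin n → ℝ => g (Matrix.of y) := hg
  have hopen : IsOpen {y : Fin p → Fin n → ℝ | g (Matrix.of y) < δ} :=
    isOpen_lt hg' continuous_const
  have hmem : x ∈ {y : Fin p → Fin n → ℝ | g (Matrix.of y) < δ} := by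
    simpa [g, frobeniusNorm] using hδ
  have hpos := hx _ (mem_nhdsWithin_of_mem_nhds (hopen.mem_nhds hmem))
  rw [Measure.map_apply hmeas hopen.measurableSet] at hpos
  refine ⟨_, F (Matrix.of x), hmeas hopen.measurableSet, hpos, fun ω hω f hf => ?_⟩
  rw [← map_sub]
  exact (abs_apply_le_of_le_nuclearNorm hf _).trans_lt hω

/-- Closed spectral balls are compact, so `F` is bounded where the conditioned matrix lives. -/
theorem integrable_entries_cond (μ : Measure Ω) [IsFiniteMeasure μ] (hX : IsRandomMatrix X)
    (hF : Continuous F) {κ : ℝ} {G : Set Ω} (hG : MeasurableSet G)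
    (hGκ : ∀ ω ∈ G, spectralNorm (X ω) < κ) (i : Fin p') (j : Fin n') :
    Integrable (fun ω => F (X ω) i j) (cond μ G) := by
  have hcont : Continuous fun M => F M i j := hF.matrix_elem i j
  obtain ⟨B, hB⟩ := (isCompact_spectralNorm_le (p := p) (n := n) κ).exists_bound_of_continuousOn
    hcont.continuousOn
  refine Integrable.of_bound (hX.measurable_comp hcont).aestronglyMeasurable B ?_
  exact ae_cond_of_forall_mem hG fun ω hω => hB _ (hGκ ω hω).le

theorem exists_tail_of_convexOn_of_lipschitz {ν : Measure Ω} [IsFiniteMeasure ν]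
    {C c q σ L : ℝ} (hL : 0 < L)
    (hconc : ∀ f : Matrix (Fin p) (Fin n) ℝ → ℝ,
      (∀ x y, |f x - f y| ≤ frobeniusNorm (x - y)) → QuasiconvexOn ℝ Set.univ f →
        Integrable (fun ω => f (X ω)) ν ∧ ∀ t : ℝ, 0 < t →
          ν.real {ω | t ≤ |f (X ω) - ∫ ω', f (X ω') ∂ν|} ≤ C * Real.exp (-(t / (c * σ)) ^ q))
    {h : Matrix (Fin p) (Fin n) ℝ → ℝ} (hconv : ConvexOn ℝ Set.univ h)
    (hlip : ∀ x y, |h x - h y| ≤ L * frobeniusNorm (x - y)) :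
    ∃ a : ℝ, ∀ t : ℝ, 0 < t →
      ν.real {ω | t ≤ |h (X ω) - a|} ≤ C * Real.exp (-(t / (L * (c * σ))) ^ q) := by
  have h1 := (hconc (fun x => L⁻¹ * h x) ?_ ?_).2
  · refine ⟨L * ∫ ω', L⁻¹ * h (X ω') ∂ν, fun t ht => ?_⟩
    have h2 := h1 (t / L) (by positivity)
    rw [div_div] at h2
    refine le_trans (measureReal_mono fun ω hω => ?_) h2
    have h3 : h (X ω) - L * ∫ ω', L⁻¹ * h (X ω') ∂ν
        = L * (L⁻¹ * h (X ω) - ∫ ω', L⁻¹ * h (X ω') ∂ν) := by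
      rw [mul_sub, mul_inv_cancel_left₀ hL.ne']
    simp only [Set.mem_ofPred_eq] at hω ⊢
    rwa [h3, abs_mul, abs_of_pos hL, ← div_le_iff₀' hL] at hω
  · intro x y
    rw [← mul_sub, abs_mul, abs_of_pos (inv_pos.mpr hL), inv_mul_le_iff₀ hL]
    exact hlip x y
  · exact (hconv.smul (inv_pos.mpr hL).le).quasiconvexOn

/-- Concentration, given an event of probability at least one half on which `X` is spectrally
bounded, of a linear form of `F X` that has a convex decomposition. -/
theorem tail_of_hasConvexDecomposition (μ : Measure Ω) [IsProbabilityMeasure μ]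
    (hX : IsRandomMatrix X) (hF : Continuous F) {κ C c q σ L : ℝ} (hC : 0 < C) (hc : 0 < c)
    (hq : 0 < q) (hσ : 0 < σ) (hL : 0 < L) {A : Set Ω} (hA : MeasurableSet A)
    (hconc : ∀ f : Matrix (Fin p) (Fin n) ℝ → ℝ,
      (∀ x y, |f x - f y| ≤ frobeniusNorm (x - y)) → QuasiconvexOn ℝ Set.univ f →
        Integrable (fun ω => f (X ω)) (cond μ A) ∧ ∀ t : ℝ, 0 < t →
          (cond μ A).real {ω | t ≤ |f (X ω) - ∫ ω', f (X ω') ∂(cond μ A)|}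
            ≤ C * Real.exp (-(t / (c * σ)) ^ q))
    {G : Set Ω} (hG : MeasurableSet G) (hGA : G ⊆ A) (hGκ : ∀ ω ∈ G, spectralNorm (X ω) < κ)
    (hhalf : 1 / 2 ≤ μ.real G) {f : Matrix (Fin p') (Fin n') ℝ →ₗ[ℝ] ℝ}
    (hdec : HasConvexDecomposition κ L fun M => f (F M)) {t : ℝ} (ht : 0 < t) :
    (cond μ G).real {ω | t ≤ |f (F (X ω)) - f (matrixMean (cond μ G) fun ω => F (X ω))|}
      ≤ (4 * C + Real.exp ((4 * C * Real.Gamma (1 / q + 1)) ^ q)) *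
        Real.exp (-(t / (2 * (2 * (L * (c * σ))))) ^ q) := by
  obtain ⟨h₁, h₂, c₁, c₂, l₁, l₂, e⟩ := hdec
  obtain ⟨a₁, ha₁⟩ := exists_tail_of_convexOn_of_lipschitz hL hconc c₁ l₁
  obtain ⟨a₂, ha₂⟩ := exists_tail_of_convexOn_of_lipschitz hL hconc c₂ l₂
  have hG0 : μ G ≠ 0 := by
    intro h0
    rw [measureReal_def, h0, ENNReal.toReal_zero] at hhalf
    norm_num at hhalf
  have hprob : IsProbabilityMeasure (cond μ G) := cond_isProbabilityMeasure hG0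
  obtain ⟨hint, hmean⟩ := apply_matrixMean
    (integrable_entries_cond μ hX hF hG hGκ) f
  rw [hmean]
  -- The center `a₁ - a₂` depends on `f`; moving to the mean replaces it by `f` of a matrix
  -- independent of `f`.
  refine tail_around_integral hint (a := a₁ - a₂) (by positivity) hq (by positivity) ?_ ht
  clear! t
  intro t ht
  have hsub : G ∩ {ω | t ≤ |f (F (X ω)) - (a₁ - a₂)|}
      ⊆ A ∩ ({ω | t / 2 ≤ |h₁ (X ω) - a₁|} ∪ {ω | t / 2 ≤ |h₂ (X ω) - a₂|}) := by
    rintro ω ⟨hωG, hω⟩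
    refine ⟨hGA hωG, ?_⟩
    simp only [Set.mem_ofPred_eq, Set.mem_union] at hω ⊢
    rw [show f (F (X ω)) = _ from e (X ω) (hGκ ω hωG)] at hω
    have h3 : h₁ (X ω) - h₂ (X ω) - (a₁ - a₂) = (h₁ (X ω) - a₁) - (h₂ (X ω) - a₂) := by ring
    rw [h3] at hω
    have h4 := abs_sub (h₁ (X ω) - a₁) (h₂ (X ω) - a₂)
    by_contra! hcon
    linarith [hcon.1, hcon.2]
  -- Passing from conditioning on `A` to conditioning on `G` costs a factor `2`, as `G` has
  -- probability at least one half; the two convex functions cost another, whence `4 * C`.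
  have h5 := cond_real_mul_eq_inter μ hG {ω | t ≤ |f (F (X ω)) - (a₁ - a₂)|}
  have h6 := measureReal_mono (μ := μ) hsub
  rw [← cond_real_mul_eq_inter μ hA] at h6
  have h7 : (cond μ A).real ({ω | t / 2 ≤ |h₁ (X ω) - a₁|} ∪ {ω | t / 2 ≤ |h₂ (X ω) - a₂|})
      ≤ 2 * (C * Real.exp (-(t / (2 * (L * (c * σ)))) ^ q)) := by
    have h8 := ha₁ (t / 2) (by positivity)
    have h9 := ha₂ (t / 2) (by positivity)
    rw [div_div] at h8 h9
    refine (measureReal_union_le _ _).trans ?_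
    linarith
  have h10 : μ.real A ≤ 1 := measureReal_le_one
  have h11 := mul_le_of_le_one_right (measureReal_nonneg (μ := cond μ A)
    (s := {ω | t / 2 ≤ |h₁ (X ω) - a₁|} ∪ {ω | t / 2 ≤ |h₂ (X ω) - a₂|})) h10
  have h12 := mul_le_mul_of_nonneg_left hhalf (measureReal_nonneg (μ := cond μ G)
    (s := {ω | t ≤ |f (F (X ω)) - (a₁ - a₂)|}))
  linarith

end Single

/-! ### Uniform constants over the family. -/

section Family

variable {ι : Type*} {Ω : ι → Type*} [∀ k, MeasurableSpace (Ω k)]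

theorem ConvexlyConcentrated.under {E : ι → Type*} [∀ k, AddCommGroup (E k)]
    [∀ k, Module ℝ (E k)] {μ : ∀ k, Measure (Ω k)} [∀ k, IsProbabilityMeasure (μ k)]
    {nrm : ∀ k, E k → ℝ} {Z : ∀ k, Ω k → E k} {q : ℝ} {σ : ι → ℝ} (θ : ι → ℝ)
    (h : ConvexlyConcentrated μ nrm Z q σ) : ConvexlyConcentratedUnder μ nrm Z q σ θ := by
  refine ⟨fun _ => Set.univ, ⟨fun k => ⟨MeasurableSet.univ, by simp⟩, 1, 1, one_pos, one_pos,
    fun k => ?_⟩, ?_⟩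
  · simp only [Set.compl_univ, measureReal_empty, one_mul]
    positivity
  · simpa only [cond_univ] using h

/-- Transfer from convex concentration to linear concentration for functions of a random matrix
whose observations by linear forms have convex decompositions on a spectral ball that contains the
matrix with high probability. -/
theorem linearlyConcentratedUnder_of_hasConvexDecomposition
    (μ : ∀ k, Measure (Ω k)) [∀ k, IsProbabilityMeasure (μ k)] {q : ℝ} (hq : 0 < q)
    {p n p' n' : ι → ℕ} {σ κ θ L : ι → ℝ} (hσ : ∀ k, 0 < σ k) (hθ : ∀ k, 0 ≤ θ k)
    (hL : ∀ k, 0 ≤ L k) {D : ℝ} (hD : 0 < D)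
    {X : ∀ k, Ω k → Matrix (Fin (p k)) (Fin (n k)) ℝ} (hX : ∀ k, IsRandomMatrix (X k))
    (hconc : ConvexlyConcentratedUnder μ (fun _ => frobeniusNorm) X q σ θ)
    (hspec : ∃ C c : ℝ, 0 < C ∧ 0 < c ∧ ∀ k,
      (μ k).real {ω | κ k ≤ spectralNorm (X k ω)} ≤ C * Real.exp (-(c * θ k)))
    {F : ∀ k, Matrix (Fin (p k)) (Fin (n k)) ℝ → Matrix (Fin (p' k)) (Fin (n' k)) ℝ}
    (hF : ∀ k, Continuous (F k))
    (hdec : ∀ k, ∀ f : Matrix (Fin (p' k)) (Fin (n' k)) ℝ →ₗ[ℝ] ℝ,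
      (∀ M, |f M| ≤ nuclearNorm M) →
        HasConvexDecomposition (κ k) (D * L k) fun M => f (F k M)) :
    LinearlyConcentratedUnder μ (fun _ => nuclearNorm) (fun k ω => F k (X k ω)) q
      (fun k => L k * σ k) θ := by
  obtain ⟨A, ⟨hA, C₁, c₁, hC₁, hc₁, hAc⟩, C, c, hC, hc, hconc⟩ := hconc
  obtain ⟨C₂, c₂, hC₂, hc₂, hspec⟩ := hspec
  set c₃ := max c₁ (1 / c₂) with hc₃def
  have hc₃ : 0 < c₃ := lt_max_of_lt_left hc₁
  set B : ℝ := 4 * C + Real.exp ((4 * C * Real.Gamma (1 / q + 1)) ^ q) with hB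
  set b : ℝ := 4 * D * c with hb
  have hBpos : 0 < B := by positivity
  have hbpos : 0 < b := by positivity
  have hB1 : 1 ≤ B := by
    have : 0 ≤ (4 * C * Real.Gamma (1 / q + 1)) ^ q := by
      have := Real.Gamma_pos_of_pos (by positivity : 0 < 1 / q + 1)
      positivity
    have := Real.one_le_exp_iff.mpr this
    linarith
  have key : ∀ k, ∃ (G : Set (Ω k)) (Z : Matrix (Fin (p' k)) (Fin (n' k)) ℝ),
      (MeasurableSet G ∧ 0 < μ k G) ∧
      (μ k).real Gᶜ ≤ 2 * (C₁ + C₂) * Real.exp (-(θ k / c₃)) ∧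
      ∀ f : Matrix (Fin (p' k)) (Fin (n' k)) ℝ →ₗ[ℝ] ℝ, (∀ M, |f M| ≤ nuclearNorm M) →
        ∀ t : ℝ, 0 < t → (cond (μ k) G).real {ω | t ≤ |f (F k (X k ω)) - f Z|}
          ≤ (B + Real.exp 1) * Real.exp (-(t / ((b + 1) * (L k * σ k))) ^ q) := by
    intro k
    set G : Set (Ω k) := A k ∩ {ω | spectralNorm (X k ω) < κ k} with hGdef
    have hG : MeasurableSet G := (hA k).1.inter
      (measurableSet_lt ((hX k).measurable_comp continuous_spectralNorm) measurable_const)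
    have hGc : (μ k).real Gᶜ ≤ (C₁ + C₂) * Real.exp (-(θ k / c₃)) := by
      have h1 : Gᶜ ⊆ (A k)ᶜ ∪ {ω | κ k ≤ spectralNorm (X k ω)} := by
        rw [hGdef, Set.compl_inter]
        refine Set.union_subset_union_right _ fun ω hω => ?_
        simpa using hω
      have h2 : Real.exp (-(θ k / c₁)) ≤ Real.exp (-(θ k / c₃)) := by
        rw [Real.exp_le_exp, neg_le_neg_iff]
        exact div_le_div_of_nonneg_left (hθ k) hc₁ (le_max_left _ _)
      have h3 : Real.exp (-(c₂ * θ k)) ≤ Real.exp (-(θ k / c₃)) := by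
        rw [Real.exp_le_exp, neg_le_neg_iff]
        refine (div_le_div_of_nonneg_left (hθ k) (by positivity) (le_max_right c₁ _)).trans
          (le_of_eq ?_)
        rw [div_div_eq_mul_div, div_one, mul_comm]
      refine (measureReal_mono h1).trans ((measureReal_union_le _ _).trans ?_)
      rw [add_mul]
      exact add_le_add ((hAc k).trans (mul_le_mul_of_nonneg_left h2 hC₁.le))
        ((hspec k).trans (mul_le_mul_of_nonneg_left h3 hC₂.le))
    have hpos : 0 < (C₁ + C₂) * Real.exp (-(θ k / c₃)) := by positivity
    -- If `G` has probability below one half, `hGc` forces `2 * (C₁ + C₂) * exp (-(θ k / c₃))` above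
    -- one, so any event of positive probability meets the complement bound.
    rcases le_or_gt (1 / 2) ((μ k).real G) with hhalf | hhalf
    · have hG0 : 0 < μ k G := by
        refine pos_of_ne_zero fun h0 => ?_
        rw [measureReal_def, h0, ENNReal.toReal_zero] at hhalf
        norm_num at hhalf
      refine ⟨G, matrixMean (cond (μ k) G) fun ω => F k (X k ω), ⟨hG, hG0⟩, by linarith,
        fun f hf t ht => ?_⟩
      -- When `L k = 0`, division by zero makes the exponent `0 ^ q = 0`, and the bound exceeds one.
      rcases (hL k).eq_or_lt with hL0 | hLpos
      · have := cond_isProbabilityMeasure (μ := μ k) hG0.ne'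
        refine measureReal_le_one.trans ?_
        rw [← hL0]
        simp only [zero_mul, mul_zero, div_zero, Real.zero_rpow hq.ne', neg_zero, Real.exp_zero]
        linarith [Real.exp_pos 1]
      · have hσk := hσ k
        refine (tail_of_hasConvexDecomposition (μ k) (hX k) (hF k) hC hc hq hσk
          (by positivity : 0 < D * L k) (hA k).1 (hconc k) hG Set.inter_subset_left
          (fun ω hω => hω.2) hhalf (hdec k f hf) ht).trans ?_
        have h1 : 2 * (2 * (D * L k * (c * σ k))) = b * (L k * σ k) := by rw [hb]; ring
        rw [← hB, h1]
        gcongr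
        · linarith [Real.exp_pos 1]
        · linarith
    · have hδ : 0 < if L k = 0 then 1 else L k * σ k := by
        split_ifs with h0
        · exact one_pos
        · exact mul_pos (lt_of_le_of_ne (hL k) (Ne.symm h0)) (hσ k)
      obtain ⟨H, Z, hH, hH0, hnear⟩ := exists_event_near_constant (μ k) (hX k) (hF k) hδ
      refine ⟨H, Z, ⟨hH, hH0⟩, ?_, fun f hf t ht => ?_⟩
      · have h1 : (μ k).real Hᶜ ≤ 1 := measureReal_le_one
        have h2 := probReal_add_probReal_compl (μ := μ k) hG
        linarith
      · have hprob := cond_isProbabilityMeasure (μ := μ k) hH0.ne'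
        by_cases hLσ : L k = 0
        · refine measureReal_le_one.trans ?_
          rw [hLσ]
          simp only [zero_mul, mul_zero, div_zero, Real.zero_rpow hq.ne', neg_zero,
            Real.exp_zero]
          linarith [Real.exp_pos 1]
        · rw [if_neg hLσ] at hδ hnear
          -- Up to the radius `L k * σ k` the exponent is at most one, thanks to the `1` in `b + 1`,
          -- and the summand `exp 1` absorbs it; beyond the radius the deviation event is null.
          rcases le_or_gt t (L k * σ k) with htδ | htδ
          · refine measureReal_le_one.trans ?_
            have h1 : (t / ((b + 1) * (L k * σ k))) ^ q ≤ 1 := by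
              refine Real.rpow_le_one (by positivity) ?_ hq.le
              rw [div_le_one (by positivity)]
              nlinarith
            have h2 : 1 ≤ Real.exp 1 * Real.exp (-(t / ((b + 1) * (L k * σ k))) ^ q) := by
              rw [← Real.exp_add, Real.one_le_exp_iff]
              linarith
            have h3 : 0 ≤ B * Real.exp (-(t / ((b + 1) * (L k * σ k))) ^ q) := by positivity
            linarith
          · have h1 := cond_real_mul_eq_inter (μ k) hH {ω | t ≤ |f (F k (X k ω)) - f Z|}
            have h2 : H ∩ {ω | t ≤ |f (F k (X k ω)) - f Z|} = ∅ := by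
              ext ω
              simp only [Set.mem_inter_iff, Set.mem_ofPred_eq, Set.mem_empty_iff_false, iff_false,
                not_and, not_le]
              exact fun hω => (hnear ω hω f hf).trans htδ
            rw [h2, measureReal_empty, mul_eq_zero] at h1
            rcases h1 with h1 | h1
            · rw [h1]
              positivity
            · rw [measureReal_def, ENNReal.toReal_eq_zero_iff] at h1
              exact absurd h1 (by simp [hH0.ne'])
  choose G Z hG hGc htail using key
  exact ⟨G, ⟨hG, 2 * (C₁ + C₂), c₃, by positivity, hc₃, hGc⟩, Z, B + Real.exp 1, b + 1,
    by positivity, by positivity, htail⟩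

end Family

end MatrixConcentration

end

/-! ### The three concentration statements. -/

open MatrixConcentration in
theorem mainTheorem9 {ι : Type*} {Ω : ι → Type*} [∀ k, MeasurableSpace (Ω k)]
    (μ : ∀ k, Measure (Ω k)) [∀ k, IsProbabilityMeasure (μ k)]
    (q : ℝ) (hq : 0 < q) (p n m : ι → ℕ) (σ κ : ι → ℝ)
    (hσ : ∀ k, 0 < σ k) (hκ : ∀ k, 0 < κ k) :
    (∀ X : ∀ k, Ω k → Matrix (Fin (p k)) (Fin (p k)) ℝ,
      (∀ k, IsRandomMatrix (X k)) →
      (ConvexlyConcentrated μ (fun _ => frobeniusNorm) X q σ ∨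
        ConvexlyConcentratedUnder μ (fun _ => frobeniusNorm) X q σ (fun k => (p k : ℝ))) →
      (∃ C c : ℝ, 0 < C ∧ 0 < c ∧ ∀ k,
        (μ k).real {ω | κ k ≤ spectralNorm (X k ω)} ≤ C * Real.exp (-(c * (p k : ℝ)))) →
      LinearlyConcentratedUnder μ (fun _ => nuclearNorm) (fun k ω => X k ω ^ m k) q
        (fun k => Real.sqrt (p k) * (2 * Real.exp 1 * κ k) ^ ((m k : ℤ) - 1) * σ k)
        (fun k => (p k : ℝ))) ∧
    (∀ X : ∀ k, Ω k → Matrix (Fin (p k)) (Fin (n k)) ℝ,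
      (∀ k, IsRandomMatrix (X k)) →
      (ConvexlyConcentrated μ (fun _ => frobeniusNorm) X q σ ∨
        ConvexlyConcentratedUnder μ (fun _ => frobeniusNorm) X q σ
          (fun k => (p k : ℝ) + (n k : ℝ))) →
      (∃ C c : ℝ, 0 < C ∧ 0 < c ∧ ∀ k,
        (μ k).real {ω | κ k ≤ spectralNorm (X k ω)}
          ≤ C * Real.exp (-(c * ((p k : ℝ) + (n k : ℝ))))) →
      (∀ k i j, Integrable (fun ω => X k ω i j) (μ k)) →
      (∃ K : ℝ, ∀ k,
        spectralNorm (matrixMean (μ k) (X k)) ≤ K * ((p k : ℝ) + (n k : ℝ)) ^ (1 / q)) →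
      LinearlyConcentratedUnder μ (fun _ => nuclearNorm)
        (fun k ω => (X k ω * (X k ω).transpose) ^ m k) q
        (fun k => Real.sqrt ((p k : ℝ) + (n k : ℝ)) *
          (2 * Real.exp 1 * κ k) ^ (2 * (m k : ℤ) - 1) * σ k)
        (fun k => (p k : ℝ) + (n k : ℝ)) ∧
      LinearlyConcentratedUnder μ (fun _ => nuclearNorm)
        (fun k ω => (X k ω * (X k ω).transpose) ^ m k * X k ω) q
        (fun k => Real.sqrt ((p k : ℝ) + (n k : ℝ)) *
          (2 * Real.exp 1 * κ k) ^ (2 * m k) * σ k)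
        (fun k => (p k : ℝ) + (n k : ℝ))) := by
  have hbase : ∀ k, 0 < 2 * Real.exp 1 * κ k := fun k => by
    have := hκ k
    positivity
  refine ⟨fun X hX hconc hspec => ?_, fun X hX hconc hspec _ _ => ⟨?_, ?_⟩⟩
  · exact linearlyConcentratedUnder_of_hasConvexDecomposition μ hq hσ (fun k => by positivity)
      (fun k => mul_nonneg (Real.sqrt_nonneg _) (zpow_nonneg (hbase k).le _)) (D := 12)
      (by norm_num) hX (hconc.elim (fun h => h.under _) id) hspec (F := fun k M => M ^ m k)
      (fun k => by fun_prop) fun k f hf => hasConvexDecomposition_pow (hκ k) hf (m k)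
  · exact linearlyConcentratedUnder_of_hasConvexDecomposition μ hq hσ (fun k => by positivity)
      (fun k => mul_nonneg (Real.sqrt_nonneg _) (zpow_nonneg (hbase k).le _)) (D := 24)
      (by norm_num) hX (hconc.elim (fun h => h.under _) id) hspec
      (F := fun k M => (M * M.transpose) ^ m k)
      (fun k => by fun_prop) fun k f hf => hasConvexDecomposition_gram_pow (hκ k) hf (m k)
  · exact linearlyConcentratedUnder_of_hasConvexDecomposition μ hq hσ (fun k => by positivity)
      (fun k => mul_nonneg (Real.sqrt_nonneg _) (pow_nonneg (hbase k).le _)) (D := 24)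
      (by norm_num) hX (hconc.elim (fun h => h.under _) id) hspec
      (F := fun k M => (M * M.transpose) ^ m k * M)
      (fun k => by fun_prop) fun k f hf => hasConvexDecomposition_gram_pow_mul (hκ k) hf (m k)
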